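/- Let $D$ be a connected (finite-dimensional, Hausdorff) complex manifold and let $\mathcal V=\coprod_{x\in D}\mathcal V_x\to D$ be a Hermitian holomorphic line bundle. Let $\mathcal O(D,\mathcal V)$ be the space of global holomorphic sections, with the topology of uniform convergence on compact sets. Let $H$ be a (finite-dimensional, real) Lie group acting continuously on $\mathcal V\to D$ by automorphisms: every $h\in H$ acts biholomorphically on the total space by $L_h:\mathcal V\to\mathcal V$ and on the base by $x\mapsto h\cdot x$, and the induced maps $L_h:\mathcal V_x\to\mathcal V_{h\cdot x}$ are linear and unitary. Then $H$ acts on $\mathcal O(D,\mathcal V)$ by $(h\cdot s)(x)=L_h\,s(h^{-1}\cdot x)$. An \emph{anti-holomorphic bundle endomorphism} $\sigma$ of $\mathcal V$ is an anti-holomorphic map $\mathcal V\to\mathcal V$ covering an anti-holomorphic map $D\to D$, also denoted $\sigma$, such that for every $x\in D$ the induced map $\sigma_x:\mathcal V_x\to\mathcal V_{\sigma(x)}$ is a conjugate-linear isometric isomorphism. (The base map is not required to be bijective.) A (strongly continuous) unitary representation $\pi$ of $H$ on a Hilbert space $\mathcal H$ is \emph{realized in} $\mathcal O(D,\mathcal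 V)$ if there is an injective continuous linear $H$-intertwining map $\mathcal H\to\mathcal O(D,\mathcal V)$. It is \emph{multiplicity-free} if the ring of continuous $H$-intertwining endomorphisms of $\mathcal H$ is commutative. Suppose that there exists an anti-holomorphic bundle endomorphism $\sigma$ of $\mathcal V$ such that for every $x\in D$ there is $h\in H$ with $\sigma(x)=h\cdot x$. Then every unitary representation of $H$ that is realized in $\mathcal O(D,\mathcal V)$ is multiplicity-free. -/

import Mathlib

open scoped Manifold ContDiff Bundle
open Bundle

noncomputable section

namespace HoloBundle

section Antiholomorphic

variable {E E' : Type*} [NormedAddCommGroup E] [NormedSpace ℂ E]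
  [NormedAddCommGroup E'] [NormedSpace ℂ E'] {X X' : Type*} [TopologicalSpace X]
  [TopologicalSpace X'] (I : ModelWithCorners ℝ E X) (I' : ModelWithCorners ℝ E' X')
  {M M' : Type*} [TopologicalSpace M] [ChartedSpace X M] [TopologicalSpace M']
  [ChartedSpace X' M']

/-- The real differential of `f` at `x`, read in the preferred charts at `x` and `f x`, as a map
between the complex model spaces. -/
def realDifferential (f : M → M') (x : M) : E →L[ℝ] E' := mfderiv I I' f x

/-- A map `f` between complex manifolds (regarded as real manifolds through their holomorphic
charts) is anti-holomorphic if it is real differentiable and its differential is conjugate linear,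
i.e. `df ∘ J = - J ∘ df` for the complex structures `J`. -/
def IsAntiholomorphic (f : M → M') : Prop :=
  MDifferentiable I I' f ∧ ∀ (x : M) (v : E),
    realDifferential I I' f x (Complex.I • v) = -(Complex.I • realDifferential I I' f x v)

end Antiholomorphic

section Bundle

set_option linter.unusedSectionVars false

variable (E : Type*) [NormedAddCommGroup E] [NormedSpace ℂ E]
  {D : Type*} [TopologicalSpace D] [ChartedSpace E D]
  (F : Type*) [NormedAddCommGroup F] [NormedSpace ℂ F]
  (V : D → Type*) [TopologicalSpace (TotalSpace F V)]
  [∀ x, NormedAddCommGroup (V x)] [∀ x, InnerProductSpace ℂ (V x)]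
  [FiberBundle F V] [VectorBundle ℂ F V]

/-- The inner products on the fibers form a (smooth) Hermitian metric: in each local
trivialization, the inner products of constant sections are smooth functions on the base, regarded
as a real manifold. -/
def IsHermitianMetric : Prop :=
  ∀ (e : Trivialization F (π F V)) [MemTrivializationAtlas e] (v w : F),
    ContMDiffOn 𝓘(ℝ, E) 𝓘(ℝ, ℂ) ∞ (fun x => inner ℂ (e.symm x v) (e.symm x w)) e.baseSet

/-- The space `𝒪(D, V)` of global holomorphic sections. -/
abbrev HolSection : Type _ := Cₛ^ω⟮𝓘(ℂ, E); F, V⟯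

/-- The topology of uniform convergence on compact sets on `𝒪(D, V)`. -/
instance instTopologicalSpaceHolSection : TopologicalSpace (HolSection E F V) where
  IsOpen U := ∀ s ∈ U, ∃ K : Set D, IsCompact K ∧ ∃ ε : ℝ, 0 < ε ∧
    ∀ t : HolSection E F V, (∀ x ∈ K, ‖t x - s x‖ < ε) → t ∈ U
  isOpen_univ := fun _ _ => ⟨∅, isCompact_empty, 1, one_pos, fun _ _ => trivial⟩
  isOpen_inter := by
    rintro U U' hU hU' s ⟨hs, hs'⟩
    obtain ⟨K, hK, ε, hε, h⟩ := hU s hs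
    obtain ⟨K', hK', ε', hε', h'⟩ := hU' s hs'
    refine ⟨K ∪ K', hK.union hK', min ε ε', lt_min hε hε', fun t ht => ⟨h t ?_, h' t ?_⟩⟩
    · exact fun x hx => (ht x (Or.inl hx)).trans_le (min_le_left _ _)
    · exact fun x hx => (ht x (Or.inr hx)).trans_le (min_le_right _ _)
  isOpen_sUnion := by
    rintro S hS s ⟨U, hUS, hsU⟩
    obtain ⟨K, hK, ε, hε, h⟩ := hS U hUS s hsU
    exact ⟨K, hK, ε, hε, fun t ht => ⟨U, hUS, h t ht⟩⟩

/-- The sets `{t | ∀ x ∈ K, ‖t x - s x‖ < ε}`, for `K` compact and `ε > 0`, form a basis of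
neighborhoods of a section `s`. -/
theorem mem_nhds_holSection_iff (s : HolSection E F V) (U : Set (HolSection E F V)) :
    U ∈ nhds s ↔ ∃ K : Set D, IsCompact K ∧ ∃ ε : ℝ, 0 < ε ∧
      ∀ t : HolSection E F V, (∀ x ∈ K, ‖t x - s x‖ < ε) → t ∈ U := by
  rw [mem_nhds_iff]
  constructor
  · rintro ⟨W, hWU, hW, hs⟩
    obtain ⟨K, hK, ε, hε, h⟩ := hW s hs
    exact ⟨K, hK, ε, hε, fun t ht => hWU (h t ht)⟩
  · rintro ⟨K, hK, ε, hε, h⟩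
    refine ⟨{t | ∃ δ < ε, ∀ x ∈ K, ‖t x - s x‖ ≤ δ}, ?_, ?_, ⟨0, hε, by simp⟩⟩
    · rintro t ⟨δ, hδ, ht⟩
      exact h t fun x hx => (ht x hx).trans_lt hδ
    · rintro t ⟨δ, hδ, ht⟩
      refine ⟨K, hK, (ε - δ) / 2, by linarith, fun u hu => ⟨(ε + δ) / 2, by linarith, ?_⟩⟩
      intro x hx
      have h1 := hu x hx
      have h2 := ht x hx
      calc ‖u x - s x‖ = ‖(u x - t x) + (t x - s x)‖ := by congr 1; abel
        _ ≤ ‖u x - t x‖ + ‖t x - s x‖ := norm_add_le _ _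
        _ ≤ (ε + δ) / 2 := by linarith

variable (H : Type*) [Group H] [TopologicalSpace H] [MulAction H D]

/-- An action of the topological group `H` on the Hermitian holomorphic vector bundle `V → D` by
automorphisms, covering a given action on the base: it is continuous, every `h : H` acts
biholomorphically on the base and on the total space (the inverse being the action of `h⁻¹`), and
the induced maps `L h x : V x → V (h • x)` between the fibers are linear and unitary. -/
structure BundleAction where
  /-- the maps induced on the fibers -/
  L : ∀ (h : H) (x : D), V x ≃ₗᵢ[ℂ] V (h • x)
  L_one : ∀ (x : D) (v : V x),
    TotalSpace.mk' F ((1 : H) • x) (L 1 x v) = TotalSpace.mk' F x v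
  L_mul : ∀ (g h : H) (x : D) (v : V x),
    TotalSpace.mk' F ((g * h) • x) (L (g * h) x v)
      = TotalSpace.mk' F (g • h • x) (L g (h • x) (L h x v))
  continuous_base : Continuous fun p : H × D => p.1 • p.2
  continuous_total : Continuous fun p : H × TotalSpace F V =>
    TotalSpace.mk' F (p.1 • p.2.proj) (L p.1 p.2.proj p.2.snd)
  holomorphic_base : ∀ h : H, ContMDiff 𝓘(ℂ, E) 𝓘(ℂ, E) ω fun x : D => h • x
  holomorphic_total : ∀ h : H,
    ContMDiff (𝓘(ℂ, E).prod 𝓘(ℂ, F)) (𝓘(ℂ, E).prod 𝓘(ℂ, F)) ω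
      fun p : TotalSpace F V => TotalSpace.mk' F (h • p.proj) (L h p.proj p.snd)

variable {E F V H}

/-- The action of `H` on holomorphic sections by pull-back, `(h · s)(y) = L_h (s (h⁻¹ y))`. The
cast identifies the fibers at the equal points `h • h⁻¹ • y` and `y`. -/
def BundleAction.onSections (ρ : BundleAction E F V H) (h : H) (s : HolSection E F V) :
    HolSection E F V where
  toFun y := cast (congrArg V (smul_inv_smul h y)) (ρ.L h (h⁻¹ • y) (s (h⁻¹ • y)))
  contMDiff_toFun := by
    have key : (fun y : D => TotalSpace.mk' F y
        (cast (congrArg V (smul_inv_smul h y)) (ρ.L h (h⁻¹ • y) (s (h⁻¹ • y)))))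
        = (fun p : TotalSpace F V => TotalSpace.mk' F (h • p.proj) (ρ.L h p.proj p.snd)) ∘
          (fun x : D => TotalSpace.mk' F x (s x)) ∘ (fun y : D => h⁻¹ • y) := by
      funext y
      simp only [Function.comp]
      generalize_proofs hy
      revert hy
      generalize ρ.L h (h⁻¹ • y) (s (h⁻¹ • y)) = w
      revert w
      rw [smul_inv_smul h y]
      intro w hy
      rfl
    rw [key]
    exact (ρ.holomorphic_total h).comp (s.contMDiff.comp (ρ.holomorphic_base h⁻¹))

/-- The isometric conjugate linear maps `fiber x : V x → V (base x)` define an anti-holomorphic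
bundle endomorphism of the Hermitian holomorphic vector bundle `V → D`, covering the
anti-holomorphic map `base : D → D`. -/
structure AntiholEndomorphism (E : Type*) [NormedAddCommGroup E] [NormedSpace ℂ E]
    {D : Type*} [TopologicalSpace D] [ChartedSpace E D]
    (F : Type*) [NormedAddCommGroup F] [NormedSpace ℂ F]
    (V : D → Type*) [TopologicalSpace (TotalSpace F V)]
    [∀ x, NormedAddCommGroup (V x)] [∀ x, InnerProductSpace ℂ (V x)]
    [FiberBundle F V] where
  /-- the map on the base space -/
  base : D → D
  /-- the maps on the fibers -/
  fiber : ∀ x : D, V x ≃ₛₗᵢ[starRingEnd ℂ] V (base x)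
  antiholomorphic_base : IsAntiholomorphic 𝓘(ℝ, E) 𝓘(ℝ, E) base
  antiholomorphic_total :
    IsAntiholomorphic (𝓘(ℝ, E).prod 𝓘(ℝ, F)) (𝓘(ℝ, E).prod 𝓘(ℝ, F))
      fun p : TotalSpace F V => TotalSpace.mk' F (base p.proj) (fiber p.proj p.snd)

end Bundle

section Representation

variable {H : Type*} [Group H] [TopologicalSpace H]

/-- A unitary representation of the topological group `H` on the Hilbert space `W`: a homomorphism
to the unitary group of `W` which is strongly continuous. -/
structure UnitaryRep (H : Type*) [Group H] [TopologicalSpace H] (W : Type*)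
    [NormedAddCommGroup W] [InnerProductSpace ℂ W] where
  /-- the unitary operators -/
  toHom : H →* (W ≃ₗᵢ[ℂ] W)
  continuous_orbit : ∀ w : W, Continuous fun h : H => toHom h w

variable {W : Type*} [NormedAddCommGroup W] [InnerProductSpace ℂ W]

/-- The continuous `H`-intertwining endomorphisms of the representation. -/
def UnitaryRep.IsIntertwining (ϖ : UnitaryRep H W) (A : W →L[ℂ] W) : Prop :=
  ∀ (h : H) (w : W), A (ϖ.toHom h w) = ϖ.toHom h (A w)

/-- A unitary representation is multiplicity-free if the ring of its continuous intertwining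
endomorphisms is commutative. -/
def UnitaryRep.MultiplicityFree (ϖ : UnitaryRep H W) : Prop :=
  ∀ A B : W →L[ℂ] W, ϖ.IsIntertwining A → ϖ.IsIntertwining B → A ∘L B = B ∘L A

/-- A unitary representation is realized in `𝒪(D, V)` if there is an injective continuous
`H`-intertwining linear map from its Hilbert space into `𝒪(D, V)`. -/
def UnitaryRep.RealizedIn (ϖ : UnitaryRep H W)
    {E : Type*} [NormedAddCommGroup E] [NormedSpace ℂ E]
    {D : Type*} [TopologicalSpace D] [ChartedSpace E D]
    {F : Type*} [NormedAddCommGroup F] [NormedSpace ℂ F]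
    {V : D → Type*} [TopologicalSpace (TotalSpace F V)]
    [∀ x, NormedAddCommGroup (V x)] [∀ x, InnerProductSpace ℂ (V x)]
    [FiberBundle F V] [VectorBundle ℂ F V] [MulAction H D] (ρ : BundleAction E F V H) : Prop :=
  ∃ T : W →L[ℂ] HolSection E F V, Function.Injective T ∧
    ∀ (h : H) (w : W), T (ϖ.toHom h w) = ρ.onSections h (T w)

end Representation

end HoloBundle

end

namespace HoloBundle

set_option linter.unusedSectionVars false

open Metric Set Filter Topology ComplexConjugate

/-! ### Vector-valued holomorphy and polarization of sesquiholomorphic kernels. -/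

section ComplexAnalysis

/-! Let `T` realize the representation. By Riesz, each `v` in the fiber over `x` has a vector `k_v =
kernelVec T v` with `⟪k_v, w⟫ = ⟪v, T w x⟫`. These vectors are permuted equivariantly by `H`, and
injectivity of `T` makes their span dense. An intertwining operator `B` is thus encoded by its
invariant kernel `⟪k_v, B k_w⟫`. The central claim is the exchange identity `⟪k_v, B k_w⟫ = ⟪k_{σ
w}, B k_{σ v}⟫`.

For `v = w` it holds because `σ x = h • x`: in a line, `σ v` and `L_h v` differ by a phase, which
cancels (`inner_kernelVec_eq_of_orbit`). Both sides are antilinear in `v`, linear in `w` and of the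
same holomorphic type, so the diagonal determines them: locally by polarization along holomorphic
discs (`eq_zero_of_antidiagonal`, `eventually_inner_kernelVec_eq`), then globally by the identity
theorem on the connected base (`eq_of_eventuallyEq_section`).

If `k_v ↦ k_{σ v}` extended to an antiunitary `J`, the identity would say `J⁻¹ B J = B†` for every
intertwining `B`, and reversal of products would give commutativity. As the base map need not be
bijective, the range of `J` may be too small. Instead the identity for `1`, `B` and `B† B` gives
`‖B† u‖ ≤ ‖B u‖` (`norm_adjoint_apply_le_of_exchange`). So every intertwining operator is normal,
and polarizing normality makes the commutant commutative (`commute_of_forall_norm_adjoint_le`). -/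

/-- A curve of continuous linear functionals which is holomorphic pointwise is holomorphic in
norm. -/
theorem differentiableOn_of_forall_apply {W : Type*} [NormedAddCommGroup W] [NormedSpace ℂ W]
    [CompleteSpace W] {l : ℂ → W →L[ℂ] ℂ} {s : Set ℂ} (hs : IsOpen s)
    (h : ∀ u, DifferentiableOn ℂ (fun z => l z u) s) : DifferentiableOn ℂ l s := by
  intro z₀ hz₀
  obtain ⟨R, hR, hRs⟩ := nhds_basis_closedBall.mem_iff.1 (hs.mem_nhds hz₀)
  obtain ⟨M, hM⟩ : ∃ M, ∀ z : closedBall z₀ R, ‖l z‖ ≤ M := by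
    refine banach_steinhaus fun u => ?_
    obtain ⟨C, hC⟩ := (isCompact_closedBall z₀ R).exists_bound_of_continuousOn
      ((h u).mono hRs).continuousOn
    exact ⟨C, fun z => hC z z.2⟩
  have hM0 : 0 ≤ M := (norm_nonneg _).trans (hM ⟨z₀, mem_closedBall_self hR.le⟩)
  have hcont : ContinuousOn l (ball z₀ R) := by
    intro z hz
    obtain ⟨r, hr, hrs⟩ := nhds_basis_ball.mem_iff.1 (isOpen_ball.mem_nhds hz)
    refine ContinuousAt.continuousWithinAt ?_
    -- The Schwarz lemma, applied to each `l · u` with the uniform bound `M`, turns boundedness into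
    -- norm continuity.
    have hlip : ∀ w ∈ ball z r, dist (l w) (l z) ≤ 2 * M / r * dist w z := by
      intro w hw
      rw [dist_eq_norm]
      refine ContinuousLinearMap.opNorm_le_bound _ (by positivity) fun u => ?_
      have h2 : MapsTo (fun z => l z u) (ball z r) (closedBall (l z u) (2 * M * ‖u‖)) := by
        intro w hw
        rw [mem_closedBall, dist_eq_norm]
        have h3 := (l w).le_of_opNorm_le (hM ⟨w, ball_subset_closedBall (hrs hw)⟩) u
        have h4 := (l z).le_of_opNorm_le (hM ⟨z, ball_subset_closedBall hz⟩) u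
        calc ‖l w u - l z u‖ ≤ ‖l w u‖ + ‖l z u‖ := norm_sub_le _ _
          _ ≤ 2 * M * ‖u‖ := by linarith
      have h5 := Complex.dist_le_div_mul_dist_of_mapsTo_ball
        ((h u).mono (hrs.trans (ball_subset_closedBall.trans hRs))) h2 hw
      rw [dist_eq_norm] at h5
      calc ‖(l w - l z) u‖ ≤ 2 * M * ‖u‖ / r * dist w z := h5
        _ = 2 * M / r * dist w z * ‖u‖ := by ring
    refine continuousAt_of_locally_lipschitz hr (2 * M / r) fun w hw => hlip w hw
  have hR2 : closedBall z₀ (R / 2) ⊆ ball z₀ R := closedBall_subset_ball (by linarith)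
  lift R to NNReal using hR.le
  have hR' : (0 : NNReal) < R / 2 := by
    have : (0 : NNReal) < R := hR
    positivity
  have hint : CircleIntegrable l z₀ ((R / 2 : NNReal) : ℝ) := by
    refine ContinuousOn.circleIntegrable (NNReal.coe_nonneg _) (hcont.mono ?_)
    exact sphere_subset_closedBall.trans (by simpa using hR2)
  -- The Cauchy integral of the norm-continuous `l` is analytic inside the circle; it equals `l`
  -- because Cauchy's formula holds after evaluation at each `u`.
  have hps := (hasFPowerSeriesOn_cauchy_integral hint hR').differentiableOn.differentiableAt
    (Metric.eball_mem_nhds _ (by exact_mod_cast hR'))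
  refine (hps.congr_of_eventuallyEq ?_).differentiableWithinAt
  filter_upwards [ball_mem_nhds z₀ (show (0 : ℝ) < (R / 2 : NNReal) from hR')] with w hw
  have hne : ∀ z ∈ sphere z₀ ((R / 2 : NNReal) : ℝ), z - w ≠ 0 := by
    intro z hz hzw
    rw [sub_eq_zero] at hzw
    rw [mem_sphere, hzw] at hz
    exact absurd hz (ne_of_lt hw)
  have hint2 : CircleIntegrable (fun z => (z - w)⁻¹ • l z) z₀ ((R / 2 : NNReal) : ℝ) := by
    refine ContinuousOn.circleIntegrable (NNReal.coe_nonneg _) ?_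
    exact ((continuousOn_id.sub continuousOn_const).inv₀ hne).smul
      (hcont.mono (sphere_subset_closedBall.trans (by simpa using hR2)))
  ext u
  rw [smul_apply, circleIntegral,
    ContinuousLinearMap.intervalIntegral_apply hint2.out]
  have hd : DifferentiableOn ℂ (fun z => l z u) (closedBall z₀ ((R / 2 : NNReal) : ℝ)) :=
    (h u).mono ((show closedBall z₀ ((R / 2 : NNReal) : ℝ) ⊆ _ by simpa using hR2).trans
      (ball_subset_closedBall.trans hRs))
  have h6 := hd.circleIntegral_sub_inv_smul hw
  rw [circleIntegral] at h6
  simp only [smul_apply]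
  rw [h6, smul_smul, inv_mul_cancel₀ Complex.two_pi_I_ne_zero, one_smul]

/-- A function holomorphic on a disc and vanishing at its real points is zero. -/
theorem eqOn_zero_of_real_zeros {f : ℂ → ℂ} {R : ℝ} (hR : 0 < R)
    (hf : DifferentiableOn ℂ f (ball 0 R)) (h0 : ∀ t : ℝ, (t : ℂ) ∈ ball (0 : ℂ) R → f t = 0) :
    EqOn f 0 (ball 0 R) := by
  refine (hf.analyticOnNhd isOpen_ball).eqOn_zero_of_preconnected_of_frequently_eq_zero
    (convex_ball _ _).isPreconnected (mem_ball_self hR) ?_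
  have h1 : Tendsto (fun t : ℝ => (t : ℂ)) (𝓝[≠] 0) (𝓝[≠] 0) := by
    refine tendsto_nhdsWithin_iff.2 ⟨?_, ?_⟩
    · exact (Complex.continuous_ofReal.tendsto' 0 0 (by simp)).mono_left nhdsWithin_le_nhds
    · filter_upwards [self_mem_nhdsWithin] with t ht
      simpa using ht
  refine h1.frequently (Eventually.frequently ?_)
  have h2 : ∀ᶠ t : ℝ in 𝓝[≠] 0, (t : ℂ) ∈ ball (0 : ℂ) R :=
    h1.eventually (mem_nhdsWithin_of_mem_nhds (ball_mem_nhds _ hR))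
  filter_upwards [h2] with t ht using h0 t ht

/-- Polarization: a holomorphic function of two variables is determined by its values on the
totally real set of pairs `(z, conj z)`. -/
theorem eq_zero_of_antidiagonal {f : ℂ × ℂ → ℂ}
    (hf : DifferentiableOn ℂ f (ball 0 3 ×ˢ ball 0 3))
    (h0 : ∀ z ∈ ball (0 : ℂ) 3, f (z, conj z) = 0) : f (1, 0) = 0 := by
  -- In the coordinates `(p + iq, p - iq)` the antidiagonal is the set of real `p`, `q`, so the
  -- one-variable identity theorem applies first in `p`, then in `q`.
  have hmem : ∀ p q : ℂ, ‖p‖ < 3 / 2 → ‖q‖ < 3 / 2 →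
      (p + Complex.I * q, p - Complex.I * q) ∈ ball (0 : ℂ) 3 ×ˢ ball (0 : ℂ) 3 := by
    intro p q hp hq
    have h1 := norm_add_le p (Complex.I * q)
    have h2 := norm_sub_le p (Complex.I * q)
    rw [norm_mul, Complex.norm_I, one_mul] at h1 h2
    exact ⟨by rw [mem_ball_zero_iff]; linarith, by rw [mem_ball_zero_iff]; linarith⟩
  have hopen : IsOpen (ball (0 : ℂ) 3 ×ˢ ball (0 : ℂ) 3) := isOpen_ball.prod isOpen_ball
  have key1 : ∀ q : ℝ, ‖(q : ℂ)‖ < 3 / 2 → ∀ p ∈ ball (0 : ℂ) (3 / 2),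
      f (p + Complex.I * q, p - Complex.I * q) = 0 := by
    intro q hq
    refine eqOn_zero_of_real_zeros (f := fun p => f (p + Complex.I * q, p - Complex.I * q))
      (by norm_num) ?_ ?_
    · refine hf.comp (by fun_prop) fun p hp => hmem p q (by simpa using hp) hq
    · intro t ht
      have := h0 (t + Complex.I * q) (hmem t q (by simpa using ht) hq).1
      rw [← this]
      simp [sub_eq_add_neg]
  have key2 : ∀ p : ℂ, ‖p‖ < 3 / 2 → ∀ q ∈ ball (0 : ℂ) (3 / 2),
      f (p + Complex.I * q, p - Complex.I * q) = 0 := by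
    intro p hp
    refine eqOn_zero_of_real_zeros (f := fun q => f (p + Complex.I * q, p - Complex.I * q))
      (by norm_num) ?_ ?_
    · refine hf.comp (by fun_prop) fun q hq => hmem p q hp (by simpa using hq)
    · intro t ht
      exact key1 t (by simpa using ht) p (by simpa using hp)
  -- `p = 1/2`, `q = -i/2` are the coordinates of the point `(1, 0)`.
  have h := key2 (1 / 2) (by norm_num) (-(Complex.I / 2)) (by
    rw [mem_ball_zero_iff, norm_neg, norm_div, Complex.norm_I]; norm_num)
  have h3 : Complex.I * (-(Complex.I / 2)) = 1 / 2 := by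
    linear_combination (-1 / 2 : ℂ) * Complex.I_mul_I
  rw [h3] at h
  norm_num at h
  exact h

variable {W : Type*} [NormedAddCommGroup W] [InnerProductSpace ℂ W] [CompleteSpace W]

/-- A weakly antiholomorphic curve in a Hilbert space becomes holomorphic after precomposition with
the complex conjugation. -/
theorem differentiableOn_comp_conj {a : ℂ → W} {R : ℝ}
    (ha : DifferentiableOn ℂ (fun z => innerSL ℂ (a z)) (ball 0 R)) :
    DifferentiableOn ℂ (fun z => a (conj z)) (ball 0 R) := by
  intro z hz
  have hz' : conj z ∈ ball (0 : ℂ) R := by simpa using hz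
  have h1 := ((ha _ hz').differentiableAt (isOpen_ball.mem_nhds hz')).hasDerivAt
  set l := deriv (fun z => innerSL ℂ (a z)) (conj z)
  -- The Riesz vector of the derivative is the derivative of `a ∘ conj`: `innerSL` is a
  -- conjugate-linear isometry, so the little-o estimate transfers.
  obtain ⟨b, hb⟩ := (InnerProductSpace.toDual ℂ W).surjective l
  have hb' : innerSL ℂ b = l := hb
  refine HasDerivAt.differentiableAt (f' := b) ?_ |>.differentiableWithinAt
  rw [hasDerivAt_iff_isLittleO] at h1 ⊢
  have h2 : Tendsto (fun w : ℂ => conj w) (𝓝 z) (𝓝 (conj z)) :=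
    Complex.continuous_conj.tendsto z
  have h3 := (h1.comp_tendsto h2)
  rw [← Asymptotics.isLittleO_norm_norm] at h3 ⊢
  refine h3.congr (fun w => ?_) (fun w => ?_)
  · have : innerSL ℂ (a (conj w) - a (conj z) - (w - z) • b) =
        innerSL ℂ (a (conj w)) - innerSL ℂ (a (conj z)) - (conj w - conj z) • l := by
      rw [map_sub, map_sub, ← hb', map_smulₛₗ, map_sub]
    simp only [Function.comp]
    rw [← this, innerSL_apply_norm]
  · simp only [Function.comp]
    rw [← map_sub, Complex.norm_conj]

/-- The matrix coefficient of a bounded operator between the points of a weakly antiholomorphic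
curve is holomorphic in the first and antiholomorphic in the second variable, jointly. -/
theorem differentiableOn_inner_conj {a : ℂ → W} {R : ℝ}
    (ha : ∀ u, DifferentiableOn ℂ (fun z => inner ℂ (a z) u) (ball 0 R)) (B : W →L[ℂ] W) :
    DifferentiableOn ℂ (fun p : ℂ × ℂ => inner ℂ (a p.1) (B (a (conj p.2))))
      (ball 0 R ×ˢ ball 0 R) := by
  have h1 : DifferentiableOn ℂ (fun z => innerSL ℂ (a z)) (ball 0 R) :=
    differentiableOn_of_forall_apply isOpen_ball ha
  have h2 := differentiableOn_comp_conj h1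
  have h3 : DifferentiableOn ℂ (fun p : ℂ × ℂ => innerSL ℂ (a p.1)) (ball 0 R ×ˢ ball 0 R) :=
    h1.comp differentiableOn_fst fun p hp => hp.1
  have h4 : DifferentiableOn ℂ (fun p : ℂ × ℂ => B (a (conj p.2))) (ball 0 R ×ˢ ball 0 R) :=
    B.differentiable.comp_differentiableOn (h2.comp differentiableOn_snd fun p hp => hp.2)
  exact h3.clm_apply h4

/-- Two sesquiholomorphic kernels which agree on the diagonal agree. -/
theorem inner_eq_inner_of_diagonal {a a' : ℂ → W} (B : W →L[ℂ] W)
    (ha : ∀ u, DifferentiableOn ℂ (fun z => inner ℂ (a z) u) (ball 0 3))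
    (ha' : ∀ u, DifferentiableOn ℂ (fun z => inner ℂ u (a' z)) (ball 0 3))
    (h : ∀ z ∈ ball (0 : ℂ) 3, inner ℂ (a z) (B (a z)) = inner ℂ (a' z) (B (a' z))) :
    inner ℂ (a 1) (B (a 0)) = inner ℂ (a' 0) (B (a' 1)) := by
  have hc : ∀ u, DifferentiableOn ℂ (fun z => inner ℂ (a' (conj z)) u) (ball 0 3) := by
    intro u z hz
    have hz' : conj z ∈ ball (0 : ℂ) 3 := by simpa using hz
    have h1 := ((ha' u _ hz').differentiableAt (isOpen_ball.mem_nhds hz')).hasDerivAt.conj_conj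
    rw [Complex.conj_conj] at h1
    refine (h1.differentiableAt.congr_of_eventuallyEq ?_).differentiableWithinAt
    exact Eventually.of_forall fun w => by simp
  have h1 := differentiableOn_inner_conj ha B
  have h2 := differentiableOn_inner_conj hc B
  -- The second kernel has its variables swapped, so that at `(z, conj z)` it becomes `⟪a' z, B (a'
  -- z)⟫`.
  have h2' : DifferentiableOn ℂ (fun p : ℂ × ℂ => inner ℂ (a' (conj p.2)) (B (a' p.1)))
      (ball 0 3 ×ˢ ball 0 3) := by
    have h3 := h2.comp (g := fun p : ℂ × ℂ => inner ℂ (a' (conj p.1)) (B (a' (conj (conj p.2)))))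
      (f := fun p => (p.2, p.1)) (s := ball 0 3 ×ˢ ball 0 3) (by fun_prop) fun p hp => ⟨hp.2, hp.1⟩
    simpa [Function.comp_def] using h3
  have h4 := eq_zero_of_antidiagonal (h1.sub h2') fun z hz => by simpa [sub_eq_zero] using h z hz
  simpa [sub_eq_zero] using h4

end ComplexAnalysis

/-! ### From the exchange identity to normality, and from normality to commutativity. -/

section Commutant

variable {W : Type*} [NormedAddCommGroup W] [InnerProductSpace ℂ W] [CompleteSpace W]

open ContinuousLinearMap in
/-- Let `k` be a total family of vectors and `k'` a second family. If the identity, `B` and `B† B`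
satisfy the exchange identity `⟪k i, A k j⟫ = ⟪k' j, A k' i⟫`, then `‖B† u‖ ≤ ‖B u‖` for all `u`. -/
theorem norm_adjoint_apply_le_of_exchange {ι : Type*} {k k' : ι → W}
    (hk : (Submodule.span ℂ (range k)).topologicalClosure = ⊤) (B : W →L[ℂ] W)
    (h1 : ∀ i j, inner ℂ (k i) (k j) = inner ℂ (k' j) (k' i))
    (hB : ∀ i j, inner ℂ (k i) (B (k j)) = inner ℂ (k' j) (B (k' i)))
    (hBB : ∀ i j, inner ℂ (k i) ((adjoint B * B) (k j)) =
      inner ℂ (k' j) ((adjoint B * B) (k' i))) (u : W) : ‖adjoint B u‖ ≤ ‖B u‖ := by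
  -- `p c ↦ p' c` plays the role of a conjugate-linear isometry; its range need not be dense.
  set p : (ι →₀ ℂ) → W := fun c => c.sum fun i t => t • k i
  set p' : (ι →₀ ℂ) → W := fun c => c.sum fun i t => conj t • k' i
  have key : ∀ A : W →L[ℂ] W, (∀ i j, inner ℂ (k i) (A (k j)) = inner ℂ (k' j) (A (k' i))) →
      ∀ c d, inner ℂ (p c) (A (p d)) = inner ℂ (p' d) (A (p' c)) := by
    intro A hA c d
    simp only [p, p', Finsupp.sum, map_sum, sum_inner, inner_sum, map_smul, inner_smul_left,
      inner_smul_right, hA, Complex.conj_conj]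
    simp only [Finset.mul_sum]
    rw [Finset.sum_comm]
    exact Finset.sum_congr rfl fun i _ => Finset.sum_congr rfl fun j _ => by ring
  have hnorm : ∀ c, ‖p c‖ = ‖p' c‖ := by
    intro c
    have h := key 1 h1 c c
    simp only [one_apply_eq_self, inner_self_eq_norm_sq_to_K] at h
    have h' : ‖p c‖ ^ 2 = ‖p' c‖ ^ 2 := by exact_mod_cast h
    exact (sq_eq_sq₀ (norm_nonneg _) (norm_nonneg _)).1 h'
  have hnormB : ∀ c, ‖B (p c)‖ = ‖B (p' c)‖ := by
    intro c
    have h := key _ hBB c c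
    rw [mul_apply_eq_comp, mul_apply_eq_comp, adjoint_inner_right, adjoint_inner_right,
      inner_self_eq_norm_sq_to_K, inner_self_eq_norm_sq_to_K] at h
    have h' : ‖B (p c)‖ ^ 2 = ‖B (p' c)‖ ^ 2 := by exact_mod_cast h
    exact (sq_eq_sq₀ (norm_nonneg _) (norm_nonneg _)).1 h'
  have hdense : DenseRange p := by
    have h2 : range p = (Submodule.span ℂ (range k) : Set W) := by
      ext w
      rw [SetLike.mem_coe, Finsupp.mem_span_range_iff_exists_finsupp]
      rfl
    rw [DenseRange, h2]
    exact Submodule.dense_iff_topologicalClosure_eq_top.2 hk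
  refine hdense.induction_on (p := fun u => ‖adjoint B u‖ ≤ ‖B u‖) u
    (isClosed_le (by fun_prop) (by fun_prop)) fun c => ?_
  -- For `w = p d` the pairing equals `⟪p' d, B (p' c)⟫`, and Cauchy–Schwarz applies; then `w = B†
  -- (p c)` is inserted.
  have hpair : ∀ w, ‖inner ℂ (adjoint B (p c)) w‖ ≤ ‖B (p c)‖ * ‖w‖ := by
    intro w
    refine hdense.induction_on (p := fun w => ‖inner ℂ (adjoint B (p c)) w‖ ≤ ‖B (p c)‖ * ‖w‖) w
      (isClosed_le (by fun_prop) (by fun_prop)) fun d => ?_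
    rw [adjoint_inner_left, key B hB, hnormB, hnorm d, mul_comm]
    exact norm_inner_le_norm _ _
  have h3 := hpair (adjoint B (p c))
  rw [inner_self_eq_norm_sq_to_K, norm_pow, RCLike.norm_ofReal, abs_norm, sq] at h3
  rcases (norm_nonneg (adjoint B (p c))).eq_or_lt with h4 | h4
  · exact h4 ▸ norm_nonneg _
  · exact le_of_mul_le_mul_right h3 h4

open ContinuousLinearMap in
/-- A linear, star-closed set of operators all of which are normal is commutative. -/
theorem commute_of_forall_norm_adjoint_le {S : Set (W →L[ℂ] W)}
    (hadj : ∀ A ∈ S, adjoint A ∈ S) (hadd : ∀ A ∈ S, ∀ B ∈ S, A + B ∈ S)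
    (hsmul : ∀ (c : ℂ), ∀ A ∈ S, c • A ∈ S)
    (h : ∀ A ∈ S, ∀ u, ‖adjoint A u‖ ≤ ‖A u‖) {A B : W →L[ℂ] W} (hA : A ∈ S) (hB : B ∈ S) :
    A * B = B * A := by
  have hnormal : ∀ A ∈ S, star A * A = A * star A := by
    intro A hA
    refine (isStarNormal_iff_norm_eq_adjoint.2 fun u => le_antisymm ?_ (h A hA u)).star_comm_self
    simpa using h _ (hadj A hA) u
  have hstar : ∀ A ∈ S, ∀ B ∈ S, star A * B = B * star A := by
    intro A hA B hB
    have e0 := hnormal A hA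
    have e1 := hnormal B hB
    -- Normality of `A + B` and `A + iB` yields two relations whose sum is `2 A* B = 2 B A*`.
    have e2 := hnormal _ (hadd A hA B hB)
    have e3 := hnormal _ (hadd A hA _ (hsmul Complex.I B hB))
    simp only [star_add, star_smul, add_mul, mul_add, smul_mul_assoc, mul_smul_comm, e0, e1] at e2 e3
    have f2 : star A * B + star B * A = A * star B + B * star A := by
      linear_combination (norm := module) e2
    have f3 : Complex.I • (star A * B - star B * A) =
        Complex.I • (B * star A - A * star B) := by
      rw [Complex.star_def, Complex.conj_I] at e3
      linear_combination (norm := module) e3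
    have f4 := smul_right_injective _ Complex.I_ne_zero f3
    have f5 : (2 : ℂ) • (star A * B) = (2 : ℂ) • (B * star A) := by
      linear_combination (norm := module) f2 + f4
    exact smul_right_injective _ two_ne_zero f5
  simpa [star_eq_adjoint] using hstar _ (hadj A hA) B hB

end Commutant

/-! ### Antiholomorphic maps in charts. -/

section AntiholomorphicMaps

variable {E E' E'' : Type*} [NormedAddCommGroup E] [NormedSpace ℂ E]
  [NormedAddCommGroup E'] [NormedSpace ℂ E'] [NormedAddCommGroup E''] [NormedSpace ℂ E'']

/-- A map between complex normed spaces is antiholomorphic at a point if it has a conjugate linear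
differential there. -/
def AntiholomorphicAt (g : E → E') (z : E) : Prop :=
  ∃ g' : E →L[ℝ] E', HasFDerivAt g g' z ∧ ∀ v, g' (Complex.I • v) = -(Complex.I • g' v)

theorem AntiholomorphicAt.congr {g₁ g₂ : E → E'} {z : E} (hg : AntiholomorphicAt g₁ z)
    (h : g₂ =ᶠ[𝓝 z] g₁) : AntiholomorphicAt g₂ z := by
  obtain ⟨g', h', hI⟩ := hg
  exact ⟨g', h'.congr_of_eventuallyEq h, hI⟩

theorem AntiholomorphicAt.comp_differentiableAt {g : E' → E''} {f : E → E'} {z : E}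
    (hg : AntiholomorphicAt g (f z)) (hf : DifferentiableAt ℂ f z) :
    AntiholomorphicAt (fun x => g (f x)) z := by
  obtain ⟨g', h, hI⟩ := hg
  refine ⟨g' ∘L (fderiv ℂ f z).restrictScalars ℝ,
    h.comp z (hf.hasFDerivAt.restrictScalars ℝ), fun v => ?_⟩
  simp [hI]

theorem DifferentiableAt.comp_antiholomorphicAt {g : E' → E''} {f : E → E'} {z : E}
    (hg : DifferentiableAt ℂ g (f z)) (hf : AntiholomorphicAt f z) :
    AntiholomorphicAt (fun x => g (f x)) z := by
  obtain ⟨f', h, hI⟩ := hf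
  refine ⟨(fderiv ℂ g (f z)).restrictScalars ℝ ∘L f',
    (hg.hasFDerivAt.restrictScalars ℝ).comp z h, fun v => ?_⟩
  simp [hI]

/-- Conjugation makes the real differential commute with `i`, hence complex linear. -/
theorem AntiholomorphicAt.differentiableAt_conj {g : E → ℂ} {z : E}
    (hg : AntiholomorphicAt g z) : DifferentiableAt ℂ (fun x => conj (g x)) z := by
  obtain ⟨g', h, hI⟩ := hg
  have h1 : HasFDerivAt (fun x => conj (g x)) (Complex.conjCLE.toContinuousLinearMap ∘L g') z :=
    Complex.conjCLE.toContinuousLinearMap.hasFDerivAt.comp z h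
  set L := Complex.conjCLE.toContinuousLinearMap ∘L g'
  have hL : ∀ v, L (Complex.I • v) = Complex.I • L v := by
    intro v
    simp [L, hI]
  refine HasFDerivAt.differentiableAt (𝕜 := ℂ) (f' := ⟨⟨⟨L, map_add L⟩, fun c v => ?_⟩, L.cont⟩)
    (hasFDerivAt_of_restrictScalars ℝ h1 rfl)
  have h2 : c • v = c.re • v + c.im • (Complex.I • v) := by
    conv_lhs => rw [← Complex.re_add_im c]
    rw [add_smul, mul_smul]
    simp only [Complex.coe_smul]
  change L (c • v) = c • L v
  rw [h2, map_add, map_smul, map_smul, hL]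
  conv_rhs => rw [← Complex.re_add_im c]
  rw [add_smul, mul_smul]
  simp only [Complex.coe_smul]

variable {X X' : Type*} [TopologicalSpace X]
  [TopologicalSpace X'] {I : ModelWithCorners ℝ E X} {I' : ModelWithCorners ℝ E' X'}
  {M M' : Type*} [TopologicalSpace M] [ChartedSpace X M] [TopologicalSpace M']
  [ChartedSpace X' M']

theorem IsAntiholomorphic.antiholomorphicAt [I.Boundaryless] {f : M → M'}
    (hf : IsAntiholomorphic I I' f) (x : M) :
    AntiholomorphicAt (writtenInExtChartAt I I' x f) (extChartAt I x x) := by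
  have h1 : HasFDerivWithinAt (writtenInExtChartAt I I' x f) (realDifferential I I' f x)
      (range I) (extChartAt I x x) := (hf.1 x).hasMFDerivAt.2
  rw [I.range_eq_univ, hasFDerivWithinAt_univ] at h1
  exact ⟨_, h1, hf.2 x⟩

end AntiholomorphicMaps

/-! ### Pull-back of holomorphic sections by an antiholomorphic endomorphism. -/

section Sections

variable {E : Type*} [NormedAddCommGroup E] [NormedSpace ℂ E]
  {D : Type*} [TopologicalSpace D] [ChartedSpace E D]
  {F : Type*} [NormedAddCommGroup F] [NormedSpace ℂ F]
  {V : D → Type*} [TopologicalSpace (TotalSpace F V)]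
  [∀ x, NormedAddCommGroup (V x)] [∀ x, InnerProductSpace ℂ (V x)]
  [FiberBundle F V]

theorem AntiholEndomorphism.continuous_base (σ : AntiholEndomorphism E F V) :
    Continuous σ.base :=
  σ.antiholomorphic_base.1.continuous

/-- The base map of an antiholomorphic endomorphism, in charts. -/
theorem AntiholEndomorphism.antiholomorphicAt_base (σ : AntiholEndomorphism E F V) (x₀ : D) :
    AntiholomorphicAt (fun z => chartAt E (σ.base x₀) (σ.base ((chartAt E x₀).symm z)))
      (chartAt E x₀ x₀) :=
  σ.antiholomorphic_base.antiholomorphicAt x₀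

/-- The local coordinate of the image of a frame under an antiholomorphic endomorphism. -/
theorem AntiholEndomorphism.antiholomorphicAt_frame (σ : AntiholEndomorphism E F V) (x₀ : D)
    (f : F) :
    AntiholomorphicAt (fun z => (trivializationAt F V (σ.base x₀)
      (TotalSpace.mk' F (σ.base ((chartAt E x₀).symm z)) (σ.fiber _
        ((trivializationAt F V x₀).symm ((chartAt E x₀).symm z) f)))).2) (chartAt E x₀ x₀) := by
  set e := trivializationAt F V x₀
  have hx₀ : x₀ ∈ e.baseSet := FiberBundle.mem_baseSet_trivializationAt' x₀
  set p₀ : TotalSpace F V := TotalSpace.mk' F x₀ (e.symm x₀ f)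
  have h1 := σ.antiholomorphic_total.antiholomorphicAt p₀
  have h2 : extChartAt (𝓘(ℝ, E).prod 𝓘(ℝ, F)) p₀ p₀ = (chartAt E x₀ x₀, f) := by
    rw [FiberBundle.extChartAt]
    have h0 : trivializationAt F V x₀ ⟨x₀, e.symm x₀ f⟩ = (x₀, f) := e.apply_mk_symm hx₀ f
    simp [p₀, h0]
  rw [h2] at h1
  -- In total-space coordinates the frame is the slice `z ↦ (z, f)`.
  have h3 := DifferentiableAt.comp_antiholomorphicAt (g := (Prod.snd : E × F → F))
    differentiableAt_snd (h1.comp_differentiableAt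
      (f := fun z => (z, f)) (z := chartAt E x₀ x₀) (by fun_prop))
  refine h3.congr ?_
  have h4 : ∀ᶠ z in 𝓝 (chartAt E x₀ x₀), (chartAt E x₀).symm z ∈ e.baseSet := by
    refine ((chartAt E x₀).continuousAt_symm (mem_chart_target E x₀)).eventually ?_
    rw [(chartAt E x₀).left_inv (mem_chart_source E x₀)]
    exact e.open_baseSet.mem_nhds hx₀
  filter_upwards [h4] with z hz
  have h5 : (extChartAt (𝓘(ℝ, E).prod 𝓘(ℝ, F)) p₀).symm (z, f) =
      TotalSpace.mk' F ((chartAt E x₀).symm z) (e.symm ((chartAt E x₀).symm z) f) := by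
    rw [FiberBundle.extChartAt]
    simpa using (e.mk_symm hz f).symm
  simp only [writtenInExtChartAt, Function.comp]
  rw [h5, FiberBundle.extChartAt]
  rfl

/-- Polarization: norms are preserved, while conjugate linearity exchanges the two imaginary terms.
-/
theorem AntiholEndomorphism.inner_fiber (σ : AntiholEndomorphism E F V) {x : D} (v w : V x) :
    inner ℂ (σ.fiber x v) (σ.fiber x w) = inner ℂ w v := by
  have h1 : ∀ u : V x, ‖σ.fiber x u‖ = ‖u‖ := (σ.fiber x).norm_map
  have h2 : (RCLike.I : ℂ) • σ.fiber x w = - σ.fiber x ((RCLike.I : ℂ) • w) := by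
    rw [map_smulₛₗ]
    simp
  rw [← inner_conj_symm w v, inner_eq_sum_norm_sq_div_four, inner_eq_sum_norm_sq_div_four v w,
    h2, sub_neg_eq_add, ← sub_eq_add_neg, ← map_add, ← map_sub, ← map_add, ← map_sub]
  simp only [h1]
  simp [Complex.conj_ofNat]
  ring

variable [VectorBundle ℂ F V]

/-- The pull-back of a section under an antiholomorphic endomorphism. -/
def AntiholEndomorphism.pullback (σ : AntiholEndomorphism E F V) (s : ∀ x, V x) (x : D) : V x :=
  (σ.fiber x).symm (s (σ.base x))

/-- The pull-back of a holomorphic section of a line bundle under an antiholomorphic endomorphism is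
holomorphic. -/
theorem AntiholEndomorphism.mdifferentiable_pullback [IsManifold 𝓘(ℂ, E) ω D]
    (hF : Module.finrank ℂ F = 1) (σ : AntiholEndomorphism E F V) {s : ∀ x, V x}
    (hs : MDifferentiable 𝓘(ℂ, E) (𝓘(ℂ, E).prod 𝓘(ℂ, F)) fun x => TotalSpace.mk' F x (s x)) :
    MDifferentiable 𝓘(ℂ, E) (𝓘(ℂ, E).prod 𝓘(ℂ, F))
      fun x => TotalSpace.mk' F x (σ.pullback s x) := by
  intro x₀
  rw [mdifferentiableAt_section]
  have : FiniteDimensional ℂ F := Module.finite_of_finrank_eq_succ hF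
  obtain ⟨ev⟩ : Nonempty (F ≃L[ℂ] ℂ) :=
    FiniteDimensional.nonempty_continuousLinearEquiv_of_finrank_eq (by simpa using hF)
  set f₀ := ev.symm 1
  set e := trivializationAt F V x₀
  set e' := trivializationAt F V (σ.base x₀)
  set φ := chartAt E x₀
  set φ' := chartAt E (σ.base x₀)
  have hx₀ : x₀ ∈ e.baseSet := FiberBundle.mem_baseSet_trivializationAt' x₀
  have hσx₀ : σ.base x₀ ∈ e'.baseSet := FiberBundle.mem_baseSet_trivializationAt' _
  -- `α` and `β` are the coordinates of the image of the frame and of `s ∘ σ`. If `μ` is the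
  -- coordinate of the pull-back, then `β = conj μ * α`, so `μ = conj β / conj α` is holomorphic.
  set α : E → ℂ := fun z => ev (e' (TotalSpace.mk' F (σ.base (φ.symm z)) (σ.fiber _
        (e.symm (φ.symm z) f₀)))).2
  set β : E → ℂ := fun z => ev (e' (TotalSpace.mk' F (σ.base (φ.symm z)) (s (σ.base (φ.symm z))))).2
  have hφc : Tendsto φ.symm (𝓝 (φ x₀)) (𝓝 x₀) := by
    have := φ.continuousAt_symm (mem_chart_target E x₀)
    rwa [ContinuousAt, φ.left_inv (mem_chart_source E x₀)] at this
  have hα : AntiholomorphicAt α (φ x₀) :=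
    DifferentiableAt.comp_antiholomorphicAt ev.differentiableAt (σ.antiholomorphicAt_frame x₀ f₀)
  have hβ : AntiholomorphicAt β (φ x₀) := by
    have h1 := hs (σ.base x₀)
    rw [mdifferentiableAt_section, mdifferentiableAt_iff] at h1
    have h2 : DifferentiableAt ℂ (fun z => (e' (TotalSpace.mk' F (φ'.symm z)
      (s (φ'.symm z)))).2) (φ' (σ.base x₀)) := by
      have h0 := h1.2
      rw [ModelWithCorners.range_eq_univ, differentiableWithinAt_univ] at h0
      exact h0
    have h3 := DifferentiableAt.comp_antiholomorphicAt ev.differentiableAt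
      (DifferentiableAt.comp_antiholomorphicAt
      (f := fun z => φ' (σ.base (φ.symm z))) (z := φ x₀)
      (by rw [φ.left_inv (mem_chart_source E x₀)]; exact h2) (σ.antiholomorphicAt_base x₀))
    refine h3.congr ?_
    have h4 : ∀ᶠ z in 𝓝 (φ x₀), σ.base (φ.symm z) ∈ φ'.source :=
      ((σ.continuous_base.tendsto x₀).comp hφc).eventually
        (φ'.open_source.mem_nhds (mem_chart_source E _))
    filter_upwards [h4] with z hz
    rw [φ'.left_inv hz]
  have key : ∀ᶠ x in 𝓝 x₀, (e (TotalSpace.mk' F x (σ.pullback s x))).2 =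
      (conj (β (φ x)) / conj (α (φ x))) • f₀ ∧ conj (α (φ x)) ≠ 0 := by
    filter_upwards [e.open_baseSet.mem_nhds hx₀, φ.open_source.mem_nhds (mem_chart_source E x₀),
      (σ.continuous_base.tendsto x₀).eventually (e'.open_baseSet.mem_nhds hσx₀)] with x hx hφx hσx
    have hαx : α (φ x) = ev (e' (TotalSpace.mk' F (σ.base x) (σ.fiber x (e.symm x f₀)))).2 :=
      congrArg (fun x => ev (e' (TotalSpace.mk' F (σ.base x) (σ.fiber x (e.symm x f₀)))).2)
        (φ.left_inv hφx)
    have hβx : β (φ x) = ev (e' (TotalSpace.mk' F (σ.base x) (s (σ.base x)))).2 :=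
      congrArg (fun x => ev (e' (TotalSpace.mk' F (σ.base x) (s (σ.base x)))).2) (φ.left_inv hφx)
    rw [hαx, hβx]
    set L := e.continuousLinearEquivAt ℂ x hx
    set L' := e'.continuousLinearEquivAt ℂ (σ.base x) hσx
    change L (σ.pullback s x) = (conj (ev (L' (s (σ.base x)))) /
      conj (ev (L' (σ.fiber x (L.symm f₀))))) • f₀ ∧ conj (ev (L' (σ.fiber x (L.symm f₀)))) ≠ 0
    have hα0 : conj (ev (L' (σ.fiber x (L.symm f₀)))) ≠ 0 := by
      simp [f₀]
    refine ⟨?_, hα0⟩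
    set μ := ev (L (σ.pullback s x)) with hμ
    have h1 : L (σ.pullback s x) = μ • f₀ := by
      apply ev.injective
      simp [f₀, hμ]
    have h2 : σ.pullback s x = μ • L.symm f₀ := by
      rw [← map_smul, ← h1, L.symm_apply_apply]
    have h3 : s (σ.base x) = conj μ • σ.fiber x (L.symm f₀) := by
      rw [← map_smulₛₗ, ← h2, AntiholEndomorphism.pullback, LinearIsometryEquiv.apply_symm_apply]
    rw [h1, h3, map_smul, map_smul, smul_eq_mul, map_mul, Complex.conj_conj,
      mul_div_cancel_right₀ _ hα0]
  have h5 : DifferentiableAt ℂ (fun z => (conj (β z) / conj (α z)) • f₀) (φ x₀) := by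
    simp only [div_eq_mul_inv]
    exact (hβ.differentiableAt_conj.mul
      (hα.differentiableAt_conj.inv key.self_of_nhds.2)).smul_const f₀
  have h6 : MDifferentiableAt 𝓘(ℂ, E) 𝓘(ℂ, E) φ x₀ :=
    mdifferentiableAt_extChartAt (I := 𝓘(ℂ, E)) (mem_chart_source E x₀)
  refine (h5.mdifferentiableAt.comp x₀ h6).congr_of_eventuallyEq ?_
  filter_upwards [key] with x hx using hx.1

end Sections

/-! ### Holomorphic discs and the identity theorem for sections. -/

section Continuation

variable {E : Type*} [NormedAddCommGroup E] [NormedSpace ℂ E]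
  {D : Type*} [TopologicalSpace D] [ChartedSpace E D] [IsManifold 𝓘(ℂ, E) ω D]

/-- Every point has arbitrarily small neighborhoods any two points of which lie on a common
holomorphic disc. -/
theorem exists_nhds_forall_exists_disc {O : Set D} {x₀ : D} (hO : O ∈ 𝓝 x₀) :
    ∃ N ∈ 𝓝 x₀, N ⊆ O ∧ ∀ x ∈ N, ∀ y ∈ N, ∃ γ : ℂ → D, γ 0 = y ∧ γ 1 = x ∧
      MDifferentiableOn 𝓘(ℂ, ℂ) 𝓘(ℂ, E) γ (ball 0 3) ∧ MapsTo γ (ball 0 3) O := by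
  set φ := chartAt E x₀
  have h1 : φ.symm ⁻¹' O ∩ φ.target ∈ 𝓝 (φ x₀) := by
    refine inter_mem ((φ.continuousAt_symm (mem_chart_target E x₀)).preimage_mem_nhds ?_)
      (φ.open_target.mem_nhds (mem_chart_target E x₀))
    rwa [φ.left_inv (mem_chart_source E x₀)]
  obtain ⟨r, hr, hrs⟩ := nhds_basis_ball.mem_iff.1 h1
  -- With both points within `r/7` of the center, the affine line through them stays in the `r`-ball
  -- for `‖t‖ < 3`, since `1 + 3 * 2 = 7`.
  have hsub : ∀ x ∈ φ.source, φ x ∈ ball (φ x₀) (r / 7) → x ∈ O := by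
    intro x hx hx'
    have := (hrs (ball_subset_ball (by linarith) hx')).1
    rwa [mem_preimage, φ.left_inv hx] at this
  refine ⟨φ.source ∩ φ ⁻¹' ball (φ x₀) (r / 7), ?_, fun x hx => hsub x hx.1 hx.2, ?_⟩
  · exact inter_mem (φ.open_source.mem_nhds (mem_chart_source E x₀))
      ((φ.continuousAt (mem_chart_source E x₀)).preimage_mem_nhds (ball_mem_nhds _ (by linarith)))
  rintro x ⟨hx, hx'⟩ y ⟨hy, hy'⟩
  have hline : MapsTo (fun t : ℂ => φ y + t • (φ x - φ y)) (ball 0 3) (ball (φ x₀) r) := by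
    intro t ht
    rw [mem_preimage, mem_ball_iff_norm] at hx' hy'
    rw [mem_ball_zero_iff] at ht
    rw [mem_ball_iff_norm]
    have h2 : ‖φ x - φ y‖ ≤ ‖φ x - φ x₀‖ + ‖φ y - φ x₀‖ := by
      rw [← sub_sub_sub_cancel_right (φ x) (φ y) (φ x₀)]
      exact norm_sub_le _ _
    calc ‖φ y + t • (φ x - φ y) - φ x₀‖ = ‖(φ y - φ x₀) + t • (φ x - φ y)‖ := by
          congr 1; abel
      _ ≤ ‖φ y - φ x₀‖ + ‖t‖ * ‖φ x - φ y‖ := (norm_add_le _ _).trans_eq (by rw [norm_smul])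
      _ ≤ ‖φ y - φ x₀‖ + 3 * (‖φ x - φ x₀‖ + ‖φ y - φ x₀‖) := by gcongr
      _ < r := by linarith
  refine ⟨fun t => φ.symm (φ y + t • (φ x - φ y)), ?_, ?_, ?_, fun t ht => (hrs (hline ht)).1⟩
  · simp [φ.left_inv hy]
  · simp [φ.left_inv hx]
  · have h3 : MDifferentiableOn 𝓘(ℂ, E) 𝓘(ℂ, E) φ.symm φ.target :=
      mdifferentiableOn_atlas_symm (chart_mem_atlas E x₀)
    have h4 : Differentiable ℂ fun t : ℂ => φ y + t • (φ x - φ y) := by fun_prop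
    exact h3.comp h4.mdifferentiable.mdifferentiableOn fun t ht => (hrs (hline ht)).2

variable {F : Type*} [NormedAddCommGroup F] [NormedSpace ℂ F]
  {V : D → Type*} [TopologicalSpace (TotalSpace F V)]
  [∀ x, NormedAddCommGroup (V x)] [∀ x, InnerProductSpace ℂ (V x)]
  [FiberBundle F V] [VectorBundle ℂ F V] [ContMDiffVectorBundle ω F V 𝓘(ℂ, E)]

/-- The coordinates of a holomorphic section along a holomorphic disc are holomorphic. -/
theorem differentiableOn_coord_comp {x₀ : D} {γ : ℂ → D}
    (hγ : MDifferentiableOn 𝓘(ℂ, ℂ) 𝓘(ℂ, E) γ (ball 0 3))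
    (hmaps : MapsTo γ (ball 0 3) (trivializationAt F V x₀).baseSet) {s : ∀ x, V x}
    (hs : MDifferentiable 𝓘(ℂ, E) (𝓘(ℂ, E).prod 𝓘(ℂ, F)) fun x => TotalSpace.mk' F x (s x)) :
    DifferentiableOn ℂ
      (fun t => (trivializationAt F V x₀ (TotalSpace.mk' F (γ t) (s (γ t)))).2) (ball 0 3) := by
  have : ContMDiffVectorBundle 1 F V 𝓘(ℂ, E) := ContMDiffVectorBundle.of_le le_top
  have : IsManifold 𝓘(ℂ, E) 1 D := IsManifold.of_le (n := ω) le_top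
  have h1 := ((trivializationAt F V x₀).mdifferentiableOn_section_iff
    (trivializationAt F V x₀).open_baseSet subset_rfl).1 hs.mdifferentiableOn
  exact (h1.comp hγ hmaps).differentiableOn

/-- The identity theorem for holomorphic sections. -/
theorem eq_of_eventuallyEq_section [CompleteSpace F] [PreconnectedSpace D] {s s' : ∀ x, V x}
    (hs : MDifferentiable 𝓘(ℂ, E) (𝓘(ℂ, E).prod 𝓘(ℂ, F)) fun x => TotalSpace.mk' F x (s x))
    (hs' : MDifferentiable 𝓘(ℂ, E) (𝓘(ℂ, E).prod 𝓘(ℂ, F)) fun x => TotalSpace.mk' F x (s' x))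
    {y : D} (h : ∀ᶠ x in 𝓝 y, s x = s' x) : s = s' := by
  set A : Set D := {x | ∀ᶠ y in 𝓝 x, s y = s' y}
  have hopen : IsOpen A := isOpen_setOfPred_eventually_nhds
  have hclosed : IsClosed A := by
    refine isClosed_of_closure_subset fun x₀ hx₀ => ?_
    set e := trivializationAt F V x₀
    obtain ⟨N, hN, hNe, hdisc⟩ := exists_nhds_forall_exists_disc (E := E)
      (e.open_baseSet.mem_nhds (FiberBundle.mem_baseSet_trivializationAt' x₀))
    -- A disc from `y` to any `x` near `x₀` carries equality of coordinates from a neighborhood of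
    -- `0` to `1`.
    obtain ⟨y, hyN, hyA⟩ := mem_closure_iff_nhds.1 hx₀ N hN
    filter_upwards [hN] with x hx
    obtain ⟨γ, h0, h1, hγ, hmaps⟩ := hdisc x hx y hyN
    have h2 := differentiableOn_coord_comp hγ hmaps hs
    have h3 := differentiableOn_coord_comp hγ hmaps hs'
    have h4 : Tendsto γ (𝓝 0) (𝓝 y) := by
      have := (hγ 0 (mem_ball_self (by norm_num))).continuousWithinAt.continuousAt
        (ball_mem_nhds 0 (by norm_num))
      rwa [ContinuousAt, h0] at this
    have h5 := (h2.analyticOnNhd isOpen_ball).eqOn_of_preconnected_of_eventuallyEq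
      (h3.analyticOnNhd isOpen_ball) (convex_ball _ _).isPreconnected
      (mem_ball_self (by norm_num)) (by
        filter_upwards [h4.eventually hyA] with t ht
        rw [ht])
    have h6 := h5 (show (1 : ℂ) ∈ ball (0 : ℂ) 3 by simp)
    subst h1
    exact (e.continuousLinearEquivAt ℂ _ (hNe hx)).injective h6
  have hA : A = univ := IsClopen.eq_univ ⟨hclosed, hopen⟩ ⟨y, h⟩
  funext x
  exact (show x ∈ A from hA ▸ mem_univ x).self_of_nhds

end Continuation

/-! ### The reproducing kernel of a realization. -/

section Kernel

variable {E : Type*} [NormedAddCommGroup E] [NormedSpace ℂ E]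
  {D : Type*} [TopologicalSpace D] [ChartedSpace E D]
  {F : Type*} [NormedAddCommGroup F] [NormedSpace ℂ F]
  {V : D → Type*} [TopologicalSpace (TotalSpace F V)]
  [∀ x, NormedAddCommGroup (V x)] [∀ x, InnerProductSpace ℂ (V x)]
  [FiberBundle F V] [VectorBundle ℂ F V]

variable (E F V) in
/-- Evaluation of holomorphic sections at a point. -/
noncomputable def evalAt (x : D) : HolSection E F V →L[ℂ] V x where
  toFun s := s x
  map_add' _ _ := rfl
  map_smul' _ _ := rfl
  cont := by
    refine continuous_iff_continuousAt.2 fun s => Metric.nhds_basis_ball.tendsto_right_iff.2 ?_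
    intro ε hε
    refine (mem_nhds_holSection_iff E F V s _).2 ⟨{x}, isCompact_singleton, ε, hε, fun t ht => ?_⟩
    simpa [dist_eq_norm] using ht x rfl

variable {W : Type*} [NormedAddCommGroup W] [InnerProductSpace ℂ W] [CompleteSpace W]
  (T : W →L[ℂ] HolSection E F V)

/-- The vector representing the functional `w ↦ ⟪v, T w x⟫`. -/
noncomputable def kernelVec {x : D} (v : V x) : W :=
  (InnerProductSpace.toDual ℂ W).symm (innerSL ℂ v ∘L (evalAt E F V x ∘L T))

theorem inner_kernelVec {x : D} (v : V x) (w : W) :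
    inner ℂ (kernelVec T v) w = inner ℂ v (T w x) :=
  InnerProductSpace.toDual_symm_apply

theorem kernelVec_smul {x : D} (c : ℂ) (v : V x) : kernelVec T (c • v) = c • kernelVec T v := by
  refine ext_inner_right ℂ fun w => ?_
  rw [inner_kernelVec, inner_smul_left, inner_smul_left, inner_kernelVec]

/-- A vector `w` orthogonal to all `k_v` is orthogonal to the one with `v = T w x`, whence `‖T w x‖
= 0` for every `x`. -/
theorem span_kernelVec_eq_top (hT : Function.Injective T) :
    (Submodule.span ℂ (range fun p : TotalSpace F V => kernelVec T p.snd)).topologicalClosure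
      = ⊤ := by
  rw [Submodule.topologicalClosure_eq_top_iff, Submodule.eq_bot_iff]
  intro w hw
  rw [Submodule.mem_orthogonal] at hw
  apply hT
  rw [map_zero]
  ext x
  have h := hw (kernelVec T (T w x)) (Submodule.subset_span ⟨⟨x, T w x⟩, rfl⟩)
  rw [inner_kernelVec, inner_self_eq_zero] at h
  exact h

/-! ### Equivariance of the kernel and its values on the diagonal. -/

section Action

variable {H : Type*} [Group H] [TopologicalSpace H] [MulAction H D] (ρ : BundleAction E F V H)

theorem BundleAction.onSections_apply_smul (h : H) (s : HolSection E F V) (x : D) :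
    ρ.onSections h s (h • x) = ρ.L h x (s x) := by
  change cast (congrArg V (smul_inv_smul h (h • x)))
    (ρ.L h (h⁻¹ • h • x) (s (h⁻¹ • h • x))) = ρ.L h x (s x)
  rw [cast_eq_iff_heq]
  -- The base point is generalized because the two fibers are different types until it is
  -- substituted.
  have : ∀ y, y = x → HEq (ρ.L h y (s y)) (ρ.L h x (s x)) := by
    rintro _ rfl
    rfl
  exact this _ (inv_smul_smul h x)

variable {T ρ} {ϖ : UnitaryRep H W}

/-- Unitarity on both sides: `ϖ.toHom h` on `W` and `ρ.L h x` on the fibers. -/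
theorem kernelVec_action (hT : ∀ (h : H) (w : W), T (ϖ.toHom h w) = ρ.onSections h (T w))
    (h : H) {x : D} (v : V x) : kernelVec T (ρ.L h x v) = ϖ.toHom h (kernelVec T v) := by
  refine ext_inner_right ℂ fun w => ?_
  obtain ⟨w, rfl⟩ := (ϖ.toHom h).surjective w
  rw [inner_kernelVec, hT, ρ.onSections_apply_smul, LinearIsometryEquiv.inner_map_map,
    LinearIsometryEquiv.inner_map_map, inner_kernelVec]

variable (V) in
theorem finrank_fiber (hF : Module.finrank ℂ F = 1) (x : D) : Module.finrank ℂ (V x) = 1 := by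
  rw [← hF]
  exact (VectorBundle.continuousLinearEquivAt ℂ F V x).toLinearEquiv.finrank_eq

theorem UnitaryRep.IsIntertwining.adjoint {B : W →L[ℂ] W} (hB : ϖ.IsIntertwining B) :
    ϖ.IsIntertwining (ContinuousLinearMap.adjoint B) := by
  intro h w
  refine ext_inner_right ℂ fun u => ?_
  obtain ⟨u, rfl⟩ := (ϖ.toHom h).surjective u
  rw [ContinuousLinearMap.adjoint_inner_left, hB, LinearIsometryEquiv.inner_map_map,
    LinearIsometryEquiv.inner_map_map, ContinuousLinearMap.adjoint_inner_left]

/-- The diagonal values of an invariant kernel are constant along orbits. -/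
theorem inner_kernelVec_eq_of_orbit (hF : Module.finrank ℂ F = 1)
    (hT : ∀ (h : H) (w : W), T (ϖ.toHom h w) = ρ.onSections h (T w))
    {B : W →L[ℂ] W} (hB : ϖ.IsIntertwining B) {x y : D} {h : H} (hy : y = h • x)
    (v : V x) (w : V y) (hvw : ‖w‖ = ‖v‖) :
    inner ℂ (kernelVec T w) (B (kernelVec T w)) = inner ℂ (kernelVec T v) (B (kernelVec T v)) := by
  subst hy
  have h1 : inner ℂ (kernelVec T (ρ.L h x v)) (B (kernelVec T (ρ.L h x v))) =
      inner ℂ (kernelVec T v) (B (kernelVec T v)) := by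
    rw [kernelVec_action hT, hB, LinearIsometryEquiv.inner_map_map]
  rcases eq_or_ne v 0 with rfl | hv
  · rw [norm_zero, norm_eq_zero] at hvw
    rw [← h1, hvw, map_zero]
  have hLv : ρ.L h x v ≠ 0 := by simpa using hv
  -- Rank one makes `w` a multiple of `L_h v`; equal norms force `‖c‖ = 1`, so `conj c * c`
  -- disappears.
  obtain ⟨c, rfl⟩ := (finrank_eq_one_iff_of_nonzero' _ hLv).1 (finrank_fiber V hF (h • x)) w
  have hc : ‖c‖ = 1 := by
    rw [norm_smul, LinearIsometryEquiv.norm_map] at hvw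
    exact (mul_eq_right₀ (norm_ne_zero_iff.2 hv)).1 hvw
  rw [kernelVec_smul, map_smul, inner_smul_left, inner_smul_right, ← mul_assoc, mul_comm (conj c),
    Complex.mul_conj', hc, h1]
  simp

end Action

/-! ### The exchange identity. -/

section Exchange

variable [IsManifold 𝓘(ℂ, E) ω D] [ContMDiffVectorBundle ω F V 𝓘(ℂ, E)]
  (σ : AntiholEndomorphism E F V)

theorem holSection_mdifferentiable (s : HolSection E F V) :
    MDifferentiable 𝓘(ℂ, E) (𝓘(ℂ, E).prod 𝓘(ℂ, F)) fun x => TotalSpace.mk' F x (s x) :=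
  s.contMDiff.mdifferentiable (by simp)

/-- Expresses `k_{σ v}` through a holomorphic section, with the arguments of the inner product
opposite to those in `inner_kernelVec`: `k_{σ v}` therefore varies with the opposite holomorphic
type to `k_v`. -/
theorem inner_kernelVec_fiber {x : D} (v : V x) (u : W) :
    inner ℂ u (kernelVec T (σ.fiber x v)) = inner ℂ v (σ.pullback (T u) x) := by
  rw [← inner_conj_symm, inner_kernelVec, ← inner_conj_symm v, ← σ.inner_fiber v,
    AntiholEndomorphism.pullback, LinearIsometryEquiv.apply_symm_apply]

variable {T σ}

/-- The exchange identity holds near the diagonal as soon as it holds on the diagonal. -/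
theorem eventually_inner_kernelVec_eq (hF : Module.finrank ℂ F = 1) (B : W →L[ℂ] W)
    (hdiag : ∀ (x : D) (v : V x), inner ℂ (kernelVec T v) (B (kernelVec T v)) =
      inner ℂ (kernelVec T (σ.fiber x v)) (B (kernelVec T (σ.fiber x v)))) (y : D) :
    ∀ᶠ x in 𝓝 y, ∀ (v : V x) (w : V y), inner ℂ (kernelVec T v) (B (kernelVec T w)) =
      inner ℂ (kernelVec T (σ.fiber y w)) (B (kernelVec T (σ.fiber x v))) := by
  set e := trivializationAt F V y
  have : FiniteDimensional ℂ F := Module.finite_of_finrank_eq_succ hF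
  obtain ⟨ev⟩ : Nonempty (F ≃L[ℂ] ℂ) :=
    FiniteDimensional.nonempty_continuousLinearEquiv_of_finrank_eq (by simpa using hF)
  set n : ∀ x, V x := fun x => e.symm x (ev.symm 1)
  -- Pairing with the frame `n` itself need not be holomorphic; dividing by `‖n‖²` makes the pairing
  -- with `ν` the holomorphic coordinate.
  set ν : ∀ x, V x := fun x => ((‖n x‖ ^ 2 : ℝ) : ℂ)⁻¹ • n x
  have hn : ∀ x ∈ e.baseSet, n x ≠ 0 := by
    intro x hx h0
    have h1 : (e.continuousLinearEquivAt ℂ x hx).symm (ev.symm 1) = 0 := h0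
    rw [ContinuousLinearEquiv.map_eq_zero_iff, ContinuousLinearEquiv.map_eq_zero_iff] at h1
    exact one_ne_zero h1
  have hν0 : ∀ x ∈ e.baseSet, ν x ≠ 0 := fun x hx => by simp [ν, hn x hx]
  have hν : ∀ x ∈ e.baseSet, ∀ t : V x, inner ℂ (ν x) t = ev (e (TotalSpace.mk' F x t)).2 := by
    intro x hx t
    have h1 : t = ev (e (TotalSpace.mk' F x t)).2 • n x := by
      set L := e.continuousLinearEquivAt ℂ x hx
      change t = ev (L t) • L.symm (ev.symm 1)
      rw [← map_smul, ← map_smul, smul_eq_mul, mul_one, ev.symm_apply_apply, L.symm_apply_apply]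
    have hn2 : ((‖n x‖ : ℝ) : ℂ) ≠ 0 := by simpa using hn x hx
    generalize ev (e (TotalSpace.mk' F x t)).2 = μ at h1 ⊢
    rw [h1, inner_smul_right, inner_smul_left, inner_self_eq_norm_sq_to_K, map_inv₀,
      Complex.conj_ofReal]
    push_cast
    change μ * ((((‖n x‖ : ℝ) : ℂ) ^ 2)⁻¹ * ((‖n x‖ : ℝ) : ℂ) ^ 2) = μ
    rw [inv_mul_cancel₀ (pow_ne_zero 2 hn2), mul_one]
  obtain ⟨N, hN, hNe, hdisc⟩ := exists_nhds_forall_exists_disc (E := E)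
      (e.open_baseSet.mem_nhds (FiberBundle.mem_baseSet_trivializationAt' y))
  filter_upwards [hN] with x hx v w
  obtain ⟨γ, h0, h1, hγ, hmaps⟩ := hdisc x hx y (mem_of_mem_nhds hN)
  have key := inner_eq_inner_of_diagonal (a := fun t => kernelVec T (ν (γ t)))
    (a' := fun t => kernelVec T (σ.fiber _ (ν (γ t)))) B (fun u => ?_) (fun u => ?_)
    (fun t _ => hdiag _ _)
  · have key' : inner ℂ (kernelVec T (ν x)) (B (kernelVec T (ν y))) =
        inner ℂ (kernelVec T (σ.fiber y (ν y))) (B (kernelVec T (σ.fiber x (ν x)))) := by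
      rw [← h0, ← h1]
      exact key
    obtain ⟨a, rfl⟩ := (finrank_eq_one_iff_of_nonzero' _ (hν0 x (hNe hx))).1
      (finrank_fiber V hF x) v
    obtain ⟨b, rfl⟩ := (finrank_eq_one_iff_of_nonzero' _ (hν0 y (hNe (mem_of_mem_nhds hN)))).1
      (finrank_fiber V hF y) w
    simp only [map_smulₛₗ, kernelVec_smul, inner_smul_left, inner_smul_right, key',
      RingHom.id_apply, Complex.conj_conj]
    ring
  · refine (ev.differentiable.comp_differentiableOn (differentiableOn_coord_comp hγ hmaps
      (holSection_mdifferentiable (T u)))).congr fun t ht => ?_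
    simp only [inner_kernelVec]
    exact hν _ (hmaps ht) _
  · refine (ev.differentiable.comp_differentiableOn (differentiableOn_coord_comp hγ hmaps
      (σ.mdifferentiable_pullback hF (holSection_mdifferentiable (T u))))).congr fun t ht => ?_
    simp only [inner_kernelVec_fiber]
    exact hν _ (hmaps ht) _

/-- The exchange identity holds everywhere as soon as it holds on the diagonal. -/
theorem inner_kernelVec_eq [PreconnectedSpace D] (hF : Module.finrank ℂ F = 1) (B : W →L[ℂ] W)
    (hdiag : ∀ (x : D) (v : V x), inner ℂ (kernelVec T v) (B (kernelVec T v)) =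
      inner ℂ (kernelVec T (σ.fiber x v)) (B (kernelVec T (σ.fiber x v)))) {x y : D}
    (v : V x) (w : V y) : inner ℂ (kernelVec T v) (B (kernelVec T w)) =
      inner ℂ (kernelVec T (σ.fiber y w)) (B (kernelVec T (σ.fiber x v))) := by
  -- For fixed `w`, both sides of the identity are pairings of `v` with a holomorphic section, so
  -- agreement near `y` propagates.
  have hr : ∀ (x : D) (v : V x), inner ℂ (kernelVec T (σ.fiber y w)) (B (kernelVec T (σ.fiber x v)))
      = inner ℂ v (σ.pullback (T (ContinuousLinearMap.adjoint B (kernelVec T (σ.fiber y w)))) x) :=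
    fun x v => by rw [← inner_kernelVec_fiber, ContinuousLinearMap.adjoint_inner_left]
  have : FiniteDimensional ℂ F := Module.finite_of_finrank_eq_succ hF
  have : CompleteSpace F := FiniteDimensional.complete ℂ F
  have hs := eq_of_eventuallyEq_section (holSection_mdifferentiable (T (B (kernelVec T w))))
    (σ.mdifferentiable_pullback hF (holSection_mdifferentiable
      (T (ContinuousLinearMap.adjoint B (kernelVec T (σ.fiber y w)))))) (y := y) (by
      filter_upwards [eventually_inner_kernelVec_eq hF B hdiag y] with x hx
      refine ext_inner_left ℂ fun v => ?_
      rw [← hr, ← hx v w, inner_kernelVec])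
  rw [inner_kernelVec, hr, congrFun hs x]

end Exchange

end Kernel

end HoloBundle

/-! ### The multiplicity-freeness theorem. -/

open HoloBundle in
theorem mainTheorem5
    -- a connected complex manifold
    {E : Type*} [NormedAddCommGroup E] [NormedSpace ℂ E] [FiniteDimensional ℂ E]
    {D : Type*} [TopologicalSpace D] [T2Space D] [ConnectedSpace D] [ChartedSpace E D]
    [IsManifold 𝓘(ℂ, E) ω D]
    -- a holomorphic Hermitian line bundle over it
    {F : Type*} [NormedAddCommGroup F] [NormedSpace ℂ F] (hF : Module.finrank ℂ F = 1)
    {V : D → Type*} [TopologicalSpace (TotalSpace F V)]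
    [∀ x, NormedAddCommGroup (V x)] [∀ x, InnerProductSpace ℂ (V x)]
    [FiberBundle F V] [VectorBundle ℂ F V] [ContMDiffVectorBundle ω F V 𝓘(ℂ, E)]
    (hV : HoloBundle.IsHermitianMetric E F V)
    -- a Lie group acting on the bundle by automorphisms
    {𝔥 : Type*} [NormedAddCommGroup 𝔥] [NormedSpace ℝ 𝔥] [FiniteDimensional ℝ 𝔥]
    {H : Type*} [TopologicalSpace H] [Group H] [ChartedSpace 𝔥 H] [LieGroup 𝓘(ℝ, 𝔥) ∞ H]
    [MulAction H D] (ρ : HoloBundle.BundleAction E F V H)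
    -- an anti-holomorphic bundle endomorphism preserving every orbit on the base
    (σ : HoloBundle.AntiholEndomorphism E F V) (hσ : ∀ x : D, ∃ h : H, σ.base x = h • x)
    -- a unitary representation realized in the space of holomorphic sections
    {W : Type*} [NormedAddCommGroup W] [InnerProductSpace ℂ W] [CompleteSpace W]
    (ϖ : HoloBundle.UnitaryRep H W) (hϖ : ϖ.RealizedIn ρ) :
    ϖ.MultiplicityFree := by
  obtain ⟨T, hinj, hT⟩ := hϖ
  have hex : ∀ B : W →L[ℂ] W, ϖ.IsIntertwining B → ∀ p q : TotalSpace F V,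
      inner ℂ (kernelVec T p.snd) (B (kernelVec T q.snd)) =
        inner ℂ (kernelVec T (σ.fiber _ q.snd)) (B (kernelVec T (σ.fiber _ p.snd))) := by
    intro B hB p q
    refine inner_kernelVec_eq hF B (fun x v => ?_) _ _
    obtain ⟨h, hh⟩ := hσ x
    exact (inner_kernelVec_eq_of_orbit hF hT hB hh v _ ((σ.fiber x).norm_map v)).symm
  intro A B hA hB
  refine commute_of_forall_norm_adjoint_le (S := {B | ϖ.IsIntertwining B})
    (fun B hB => hB.adjoint) (fun A hA B hB h w => ?_) (fun c A hA h w => ?_) (fun B hB => ?_) hA hB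
  · simp [hA h w, hB h w]
  · simp [hA h w]
  -- The commutant contains `1`, `B` and `B† B`, so the exchange identity is available for all
  -- three.
  · refine norm_adjoint_apply_le_of_exchange (span_kernelVec_eq_top T hinj) B
      (hex 1 fun _ _ => rfl) (hex B hB) (hex _ fun h w => ?_)
    rw [mul_apply_eq_comp, mul_apply_eq_comp, hB, hB.adjoint]
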